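/- Let $(\Omega,\mathsf{F},\mathbb{P})$ be a probability space, $(K,\mathsf{K})$ a measurable space, and $(X,d)$ a separable Hadamard space, i.e. a separable complete geodesic metric space such that $$d^2(\gamma(tl),p)\le(1-t)\,d^2(\gamma(0),p)+t\,d^2(\gamma(l),p)-t(1-t)\,d^2(\gamma(0),\gamma(l))$$ for all $p\in X$, $t\in[0,1]$ and all geodesics (isometric maps) $\gamma:[0,l]\to X$. For $x,y\in X$ and $t\in[0,1]$ let $(1-t)x\oplus ty:=\gamma(t\,d(x,y))$, where $\gamma$ is the unique geodesic from $x$ to $y$. Let $(T_c)_{c\in K}$ be a family of nonexpansive maps $T_c:X\to X$ such that $(c,x)\mapsto T_cx$ is $\mathsf{K}\otimes\mathsf{B}(X)/\mathsf{B}(X)$-measurable, let $k:\Omega\to K$ be a random variable, and assume that $$\mathrm{Fix}\,T:=\{x\in X\mid T_kx=x\ \ \mathbb{P}\text{-a.s.}\}\neq\emptyset .$$ Put $F(x):=\mathbb{E}[d^2(T_kx,x)]$. Let $(k_n)_{n\in\mathbb{N}}$ be i.i.d. $K$-valued random variables distributed as $k$, and let $(\lambda_n)_{n\in\mathbb{N}}$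 be mutually independent random variables $\Omega\to(0,1]$ such that the sequence $(\lambda_n)$ is independent of the sequence $(k_n)$ and $\sum_{n\in\mathbb{N}}\mathbb{E}[\lambda_n(1-\lambda_n)]=\infty$. Given a (deterministic) starting point $x_0\in X$, let $$x_{n+1}:=(1-\lambda_n)x_n\oplus\lambda_nT_{k_n}x_n\qquad(n\in\mathbb{N}).$$ Let $D$ be a collection of $X$-valued random variables that contains every $x_n$, and let $\tau:(0,\infty)\to(0,\infty)$ be a modulus of regularity for $F$ in mean with respect to $D$: for all $\varepsilon>0$ and all $y\in D$, $$\mathbb{E}_{\omega\sim\mathbb{P}}\big[\mathbb{E}_{\omega'\sim\mathbb{P}}[d^2(T_{k(\omega')}y(\omega),y(\omega))]\big]<\tau(\varepsilon)\ \Longrightarrow\ \mathbb{E}[\mathrm{dist}^2_{\mathrm{Fix}\,T}(y)]<\varepsilon .$$ Then there is a $\mathrm{Fix}\,T$-valued random variable $x$ such that $d(x_n,x)\to0$ almost surely and $\mathbb{E}[d(x_n,x)]\to0$. Moreover, let $z\in\mathrm{Fix}\,T$ and $b>d^2(x_0,z)$, let $\theta:\mathbb{N}\times(0,\infty)\to\mathbb{N}$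 satisfy $\sum_{n=m}^{\theta(m,c)}\mathbb{E}[\lambda_n(1-\lambda_n)]\ge c$ for all $c>0$ and $m\in\mathbb{N}$, and put $$\rho(\varepsilon):=\theta\left(0,\frac{b}{\tau(\varepsilon/6)}\right).$$ Then $$\forall\varepsilon>0\ \forall n\ge\rho(\varepsilon^2/4):\quad\mathbb{E}[d(x_n,x)]<\varepsilon$$ and $$\forall\delta,\varepsilon>0:\quad\mathbb{P}\big(\exists n\ge\rho(\delta\varepsilon^2/4):\ d(x_n,x)\ge\varepsilon\big)<\delta .$$ -/

import Mathlib

open MeasureTheory ProbabilityTheory Filter Topology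
open scoped ENNReal

/-- `γ`, restricted to `[0, l]`, is a geodesic, i.e. an isometric embedding `[0, l] → X`. -/
def IsGeodesic {X : Type*} [MetricSpace X] (γ : ℝ → X) (l : ℝ) : Prop :=
  0 ≤ l ∧ ∀ s ∈ Set.Icc (0 : ℝ) l, ∀ t ∈ Set.Icc (0 : ℝ) l, dist (γ s) (γ t) = |s - t|

/-- `γ` is a geodesic on `[0, d(x, y)]` that joins `x` and `y`. -/
def JoinsByGeodesic {X : Type*} [MetricSpace X] (γ : ℝ → X) (x y : X) : Prop :=
  IsGeodesic γ (dist x y) ∧ γ 0 = x ∧ γ (dist x y) = y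

/-- A CAT(0) space: a geodesic metric space which satisfies the Bruhat–Tits CN-inequality.
A Hadamard space is a complete CAT(0) space. -/
class CAT0Space (X : Type*) [MetricSpace X] : Prop where
  exists_geodesic : ∀ x y : X, ∃ γ : ℝ → X, JoinsByGeodesic γ x y
  cn : ∀ (γ : ℝ → X) (l : ℝ), IsGeodesic γ l → ∀ (p : X), ∀ t ∈ Set.Icc (0 : ℝ) 1,
    dist (γ (t * l)) p ^ 2 ≤
      (1 - t) * dist (γ 0) p ^ 2 + t * dist (γ l) p ^ 2
        - t * (1 - t) * dist (γ 0) (γ l) ^ 2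

/-- The point `(1 - t) x ⊕ t y`, i.e. `γ (t d(x, y))` for the geodesic `γ` from `x` to `y`. -/
noncomputable def geodesicComb {X : Type*} [MetricSpace X] [CAT0Space X] (t : ℝ) (x y : X) : X :=
  Classical.choose (CAT0Space.exists_geodesic x y) (t * dist x y)

/-- `geodesicComb` does not depend on the choice of the geodesic. -/
theorem geodesicComb_eq {X : Type*} [MetricSpace X] [CAT0Space X] {γ : ℝ → X} {x y : X}
    (h : JoinsByGeodesic γ x y) {t : ℝ} (ht : t ∈ Set.Icc (0 : ℝ) 1) :
    geodesicComb t x y = γ (t * dist x y) := by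
  obtain ⟨⟨hl, hγ⟩, h0, h1⟩ := h
  have hs := Classical.choose_spec (CAT0Space.exists_geodesic x y)
  have hcn := CAT0Space.cn _ _ hs.1 (γ (t * dist x y)) t ht
  rw [hs.2.1, hs.2.2] at hcn
  have hm : t * dist x y ∈ Set.Icc (0 : ℝ) (dist x y) :=
    ⟨mul_nonneg ht.1 hl, mul_le_of_le_one_left hl ht.2⟩
  have e0 := hγ 0 ⟨le_refl _, hl⟩ _ hm
  have e1 := hγ (dist x y) ⟨hl, le_refl _⟩ _ hm
  rw [h0] at e0
  rw [h1] at e1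
  rw [e0, e1, sq_abs, sq_abs] at hcn
  have hz : dist (Classical.choose (CAT0Space.exists_geodesic x y) (t * dist x y))
      (γ (t * dist x y)) ^ 2 ≤ 0 := by
    refine hcn.trans (le_of_eq ?_)
    ring
  exact dist_eq_zero.1 (pow_eq_zero_iff two_ne_zero |>.1 (le_antisymm hz (sq_nonneg _)))

/-- The set `Fix T = {x | T_k x = x a.s.}` of stochastic common fixed points, for a family
`(T_c)` of self-maps of `X` and a random index `k`. -/
def commonFix {Ω K X : Type*} [MeasurableSpace Ω] (P : Measure Ω) (T : K → X → X) (k : Ω → K) :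
    Set X :=
  {x | ∀ᵐ ω ∂P, T (k ω) x = x}

/-- `F x = 𝔼[d²(T_k x, x)]`, with values in `[0, ∞]`. -/
noncomputable def meanSqResidual {Ω K X : Type*} [MeasurableSpace Ω] [MetricSpace X]
    (P : Measure Ω) (T : K → X → X) (k : Ω → K) (x : X) : ℝ≥0∞ :=
  ∫⁻ ω, edist (T (k ω) x) x ^ 2 ∂P

/-- `τ : (0, ∞) → (0, ∞)` is a modulus of `d²`-regularity in mean for `F`, with solution set `S`,
with respect to the collection `D` of `X`-valued random variables. -/
def IsRegularityModulusInMean {Ω X : Type*} [MeasurableSpace Ω] [MetricSpace X]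
    (P : Measure Ω) (F : X → ℝ≥0∞) (S : Set X) (D : Set (Ω → X)) (τ : ℝ → ℝ) : Prop :=
  (∀ ε > 0, 0 < τ ε) ∧
    ∀ ε > 0, ∀ y ∈ D, ∫⁻ ω, F (y ω) ∂P < ENNReal.ofReal (τ ε) →
      ∫⁻ ω, Metric.infEDist (y ω) S ^ 2 ∂P < ENNReal.ofReal ε

/-- The rate `ρ(ε) = θ(0, b / τ(ε / 6))`. -/
noncomputable def kmRate (θ : ℕ → ℝ → ℕ) (τ : ℝ → ℝ) (b ε : ℝ) : ℕ :=
  θ 0 (b / τ (ε / 6))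

/-! For a common fixed point `z`, the CN inequality and nonexpansiveness give, almost surely,
d²(x_{n+1}, z) + λ_n(1-λ_n) d²(T_{k_n} x_n, x_n) ≤ d²(x_n, z) (`edist_geodesicComb_sq_add_le`). As
x_n depends only on earlier indices and step sizes, the expected middle term is E[λ_n(1-λ_n)]
E[F(x_n)] (`lintegral_mul_edist_iterate`). Summing, these terms total less than b, so once the
weights add up to b/τ(ε), some E[F(x_m)] is below τ(ε) (`exists_lt_of_energy_le`), and regularity
makes E[dist²(x_m, Fix T)] < ε.

The same inequality is Fejér monotonicity: the distance to Fix T never increases, so the bound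
persists after m, and the distance to the limit is at most twice the distance to Fix T. Weighted
AM-GM then gives the rate in mean, and Markov's inequality the rate in probability. -/

section Geodesic

/-! ### Convex combinations in CAT(0) spaces. -/

variable {X : Type*} [MetricSpace X] [CAT0Space X]

theorem dist_geodesicComb_left {t : ℝ} (ht : t ∈ Set.Icc (0 : ℝ) 1) (x y : X) :
    dist (geodesicComb t x y) x = t * dist x y := by
  obtain ⟨γ, hγ⟩ := CAT0Space.exists_geodesic x y
  have hd : 0 ≤ dist x y := dist_nonneg
  rw [geodesicComb_eq hγ ht]
  have h := hγ.1.2 (t * dist x y) ⟨mul_nonneg ht.1 hd, mul_le_of_le_one_left hd ht.2⟩ 0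
    ⟨le_rfl, hd⟩
  rwa [hγ.2.1, sub_zero, abs_of_nonneg (mul_nonneg ht.1 hd)] at h

theorem dist_geodesicComb_right {t : ℝ} (ht : t ∈ Set.Icc (0 : ℝ) 1) (x y : X) :
    dist (geodesicComb t x y) y = (1 - t) * dist x y := by
  obtain ⟨γ, hγ⟩ := CAT0Space.exists_geodesic x y
  have hd : 0 ≤ dist x y := dist_nonneg
  rw [geodesicComb_eq hγ ht]
  have h := hγ.1.2 (t * dist x y) ⟨mul_nonneg ht.1 hd, mul_le_of_le_one_left hd ht.2⟩ (dist x y)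
    ⟨hd, le_rfl⟩
  rw [hγ.2.2, abs_sub_comm, abs_of_nonneg (by nlinarith [ht.2])] at h
  rw [h]; ring

theorem dist_geodesicComb_sq_le {t : ℝ} (ht : t ∈ Set.Icc (0 : ℝ) 1) (x y p : X) :
    dist (geodesicComb t x y) p ^ 2 ≤
      (1 - t) * dist x p ^ 2 + t * dist y p ^ 2 - t * (1 - t) * dist x y ^ 2 := by
  obtain ⟨γ, hγ⟩ := CAT0Space.exists_geodesic x y
  rw [geodesicComb_eq hγ ht]
  simpa only [hγ.2.1, hγ.2.2] using CAT0Space.cn γ _ hγ.1 p t ht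

/-- The convex combination is jointly continuous; the parameter is clipped to `[0, 1]`. -/
theorem continuous_geodesicComb_projIcc :
    Continuous fun q : ℝ × X × X =>
      geodesicComb (Set.projIcc (0 : ℝ) 1 zero_le_one q.1 : ℝ) q.2.1 q.2.2 := by
  set c : ℝ → ℝ := fun t => (Set.projIcc (0 : ℝ) 1 zero_le_one t : ℝ) with hc
  have hcc : Continuous c := continuous_subtype_val.comp continuous_projIcc
  have hmem : ∀ t, c t ∈ Set.Icc (0 : ℝ) 1 := fun t => Subtype.property _
  rw [continuous_iff_continuousAt]
  rintro ⟨t, x, y⟩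
  change Tendsto (fun q : ℝ × X × X => geodesicComb (c q.1) q.2.1 q.2.2) _
    (𝓝 (geodesicComb (c t) x y))
  -- This is the CN bound on the geodesic from `x` to `y`, taken at the moving combination, with its
  -- distances to `x` and `y` estimated by the triangle inequality. It vanishes at the base point
  -- because s(1-s)(s + (1-s) - 1) = 0 for s = `c t`.
  set g : ℝ × X × X → ℝ := fun q =>
    (1 - c t) * (dist x q.2.1 + c q.1 * dist q.2.1 q.2.2) ^ 2
      + c t * (dist y q.2.2 + (1 - c q.1) * dist q.2.1 q.2.2) ^ 2
      - c t * (1 - c t) * dist x y ^ 2 with hg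
  have hgc : Continuous g := by fun_prop
  have hg0 : Tendsto g (𝓝 (t, x, y)) (𝓝 0) := by
    have h := hgc.tendsto (t, x, y)
    have e : g (t, x, y) = 0 := by
      simp only [hg, dist_self]
      ring
    rwa [e] at h
  have hle : ∀ q : ℝ × X × X,
      dist (geodesicComb (c q.1) q.2.1 q.2.2) (geodesicComb (c t) x y) ≤ √(g q) := by
    intro q
    set m := geodesicComb (c q.1) q.2.1 q.2.2
    have h1 := dist_geodesicComb_sq_le (hmem t) x y m
    have h2 : dist x m ≤ dist x q.2.1 + c q.1 * dist q.2.1 q.2.2 := by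
      rw [← dist_geodesicComb_left (hmem q.1) q.2.1 q.2.2]
      exact dist_triangle_right _ _ _
    have h3 : dist y m ≤ dist y q.2.2 + (1 - c q.1) * dist q.2.1 q.2.2 := by
      rw [← dist_geodesicComb_right (hmem q.1) q.2.1 q.2.2]
      exact dist_triangle_right _ _ _
    rw [dist_comm]
    refine Real.le_sqrt_of_sq_le (h1.trans ?_)
    have := (hmem t).1
    have := sub_nonneg.2 (hmem t).2
    simp only [hg]
    gcongr
  rw [tendsto_iff_dist_tendsto_zero]
  refine squeeze_zero (fun _ => dist_nonneg) hle ?_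
  simpa using hg0.sqrt

theorem measurable_geodesicComb_projIcc [TopologicalSpace.SeparableSpace X] [MeasurableSpace X]
    [BorelSpace X] :
    Measurable fun q : ℝ × X × X =>
      geodesicComb (Set.projIcc (0 : ℝ) 1 zero_le_one q.1 : ℝ) q.2.1 q.2.2 := by
  have : SecondCountableTopology X := UniformSpace.secondCountable_of_separable X
  exact continuous_geodesicComb_projIcc.measurable

/-- A relaxed step towards the value of a map that is nonexpansive at one of its fixed points. -/
theorem edist_geodesicComb_sq_add_le {t : ℝ} (ht : t ∈ Set.Icc (0 : ℝ) 1) {x y z : X}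
    (h : dist y z ≤ dist x z) :
    edist (geodesicComb t x y) z ^ 2 + ENNReal.ofReal (t * (1 - t)) * edist y x ^ 2
      ≤ edist x z ^ 2 := by
  have h0 : 0 ≤ t * (1 - t) := mul_nonneg ht.1 (sub_nonneg.2 ht.2)
  simp only [edist_dist, ← ENNReal.ofReal_pow dist_nonneg]
  rw [← ENNReal.ofReal_mul h0, ← ENNReal.ofReal_add (sq_nonneg _) (mul_nonneg h0 (sq_nonneg _))]
  apply ENNReal.ofReal_le_ofReal
  have h1 := dist_geodesicComb_sq_le ht x y z
  have h2 : dist y z ^ 2 ≤ dist x z ^ 2 := by gcongr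
  rw [dist_comm y x]
  nlinarith [ht.1]

end Geodesic

/-! ### Fejér monotone sequences. -/

section Fejer

variable {X : Type*} [MetricSpace X]

theorem edist_le_of_fejer {u : ℕ → X} {z : X} (hu : ∀ n, edist (u (n + 1)) z ≤ edist (u n) z)
    {m n : ℕ} (hmn : m ≤ n) : edist (u n) z ≤ edist (u m) z :=
  antitone_nat_of_succ_le (f := fun n => edist (u n) z) hu hmn

theorem infEDist_le_of_fejer {S : Set X} {u : ℕ → X}
    (hu : ∀ z ∈ S, ∀ n, edist (u (n + 1)) z ≤ edist (u n) z) {m n : ℕ} (hmn : m ≤ n) :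
    Metric.infEDist (u n) S ≤ Metric.infEDist (u m) S :=
  Metric.le_infEDist.2 fun z hz =>
    (Metric.infEDist_le_edist_of_mem hz).trans (edist_le_of_fejer (hu z hz) hmn)

/-- Both points lie within `edist (u m) z` of any `z` in `S`; take the infimum over `z`. -/
theorem edist_le_two_mul_infEDist_of_fejer {S : Set X} {u : ℕ → X}
    (hu : ∀ z ∈ S, ∀ n, edist (u (n + 1)) z ≤ edist (u n) z) {m n : ℕ} (hmn : m ≤ n) :
    edist (u m) (u n) ≤ 2 * Metric.infEDist (u m) S := by
  rw [mul_comm, ← ENNReal.div_le_iff_le_mul (by simp) (by simp)]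
  refine Metric.le_infEDist.2 fun z hz => ?_
  rw [ENNReal.div_le_iff_le_mul (by simp) (by simp), mul_two]
  refine (edist_triangle_right _ _ z).trans ?_
  gcongr
  exact edist_le_of_fejer (hu z hz) hmn

theorem exists_tendsto_of_fejer [CompleteSpace X] {S : Set X} (hS : IsClosed S)
    {u : ℕ → X}
    (hu : ∀ z ∈ S, ∀ n, edist (u (n + 1)) z ≤ edist (u n) z)
    (h0 : Tendsto (fun n => Metric.infEDist (u n) S) atTop (𝓝 0)) :
    ∃ y ∈ S, Tendsto u atTop (𝓝 y) := by
  have hc : CauchySeq u := by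
    refine EMetric.cauchySeq_iff'.2 fun ε hε => ?_
    have h2 : Tendsto (fun n => 2 * Metric.infEDist (u n) S) atTop (𝓝 0) := by
      simpa using ENNReal.Tendsto.const_mul h0 (Or.inr (by simp : (2 : ℝ≥0∞) ≠ ∞))
    obtain ⟨N, hN⟩ := (h2.eventually (gt_mem_nhds hε)).exists
    refine ⟨N, fun n hn => ?_⟩
    rw [edist_comm]
    exact (edist_le_two_mul_infEDist_of_fejer hu hn).trans_lt hN
  obtain ⟨y, hy⟩ := cauchySeq_tendsto_of_complete hc
  refine ⟨y, ?_, hy⟩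
  rw [Metric.mem_iff_infEDist_zero_of_closed hS]
  exact tendsto_nhds_unique ((Metric.continuous_infEDist.tendsto y).comp hy) h0

theorem edist_limit_le_two_mul_infEDist_of_fejer {S : Set X} {u : ℕ → X}
    (hu : ∀ z ∈ S, ∀ n, edist (u (n + 1)) z ≤ edist (u n) z) {y : X}
    (hy : Tendsto u atTop (𝓝 y)) (m : ℕ) :
    edist (u m) y ≤ 2 * Metric.infEDist (u m) S :=
  le_of_tendsto (tendsto_const_nhds.edist hy)
    ((eventually_ge_atTop m).mono fun _ hn => edist_le_two_mul_infEDist_of_fejer hu hn)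

end Fejer

/-- Applied with `A`, `C` the current step size and index, and `B`, `D` their histories. The joint
law is a product of four laws, so Tonelli's theorem splits off `a` and lets `C` be replaced by an
independent copy. -/
theorem lintegral_mul_comp_of_indepFun {Ω α β γ δ X : Type*} [MeasurableSpace Ω]
    [MeasurableSpace α] [MeasurableSpace β] [MeasurableSpace γ] [MeasurableSpace δ]
    [MeasurableSpace X] {P : Measure Ω} [IsProbabilityMeasure P]
    {A : Ω → α} {B : Ω → β} {C : Ω → γ} {D : Ω → δ}
    (hA : Measurable A) (hB : Measurable B) (hC : Measurable C) (hD : Measurable D)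
    (hAB : IndepFun A B P) (hCD : IndepFun C D P)
    (hABCD : IndepFun (fun ω => (A ω, B ω)) (fun ω => (C ω, D ω)) P)
    {a : α → ℝ≥0∞} (ha : Measurable a) {h : γ → X → ℝ≥0∞} (hh : Measurable (Function.uncurry h))
    {Φ : β × δ → X} (hΦ : Measurable Φ) :
    ∫⁻ ω, a (A ω) * h (C ω) (Φ (B ω, D ω)) ∂P
      = (∫⁻ ω, a (A ω) ∂P) * ∫⁻ ω, ∫⁻ ω', h (C ω') (Φ (B ω, D ω)) ∂P ∂P := by
  have hBD : IndepFun B D P := hABCD.comp measurable_snd measurable_snd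
  have := Measure.isProbabilityMeasure_map (μ := P) hA.aemeasurable
  have := Measure.isProbabilityMeasure_map (μ := P) hB.aemeasurable
  have := Measure.isProbabilityMeasure_map (μ := P) hC.aemeasurable
  have := Measure.isProbabilityMeasure_map (μ := P) hD.aemeasurable
  rw [indepFun_iff_map_prod_eq_prod_map_map hA.aemeasurable hB.aemeasurable] at hAB
  rw [indepFun_iff_map_prod_eq_prod_map_map hC.aemeasurable hD.aemeasurable] at hCD
  rw [indepFun_iff_map_prod_eq_prod_map_map hB.aemeasurable hD.aemeasurable] at hBD
  rw [indepFun_iff_map_prod_eq_prod_map_map (hA.prodMk hB).aemeasurable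
    (hC.prodMk hD).aemeasurable, hAB, hCD] at hABCD
  have hg : Measurable fun q : (β × δ) × γ => h q.2 (Φ q.1) :=
    hh.comp (measurable_snd.prodMk (hΦ.comp measurable_fst))
  have hg' : Measurable fun q : β × (γ × δ) => h q.2.1 (Φ (q.1, q.2.2)) :=
    hg.comp (f := fun q : β × (γ × δ) => ((q.1, q.2.2), q.2.1)) (by fun_prop)
  have hL : ∫⁻ ω, a (A ω) * h (C ω) (Φ (B ω, D ω)) ∂P
      = ∫⁻ p, a p.1.1 * h p.2.1 (Φ (p.1.2, p.2.2))
          ∂(((P.map A).prod (P.map B)).prod ((P.map C).prod (P.map D))) := by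
    rw [← hABCD, lintegral_map _ ((hA.prodMk hB).prodMk (hC.prodMk hD))]
    exact (ha.comp (by fun_prop)).mul
      (hg'.comp (f := fun p : (α × β) × (γ × δ) => (p.1.2, p.2)) (by fun_prop))
  have hR : ∫⁻ ω, ∫⁻ ω', h (C ω') (Φ (B ω, D ω)) ∂P ∂P
      = ∫⁻ q, ∫⁻ c, h c (Φ q) ∂(P.map C) ∂((P.map B).prod (P.map D)) := by
    rw [← hBD, lintegral_map hg.lintegral_prod_right' (hB.prodMk hD)]
    refine lintegral_congr fun ω => ?_
    exact (lintegral_map (f := fun c => h c (Φ (B ω, D ω)))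
      (hg.comp (measurable_prodMk_left (x := (B ω, D ω)))) hC).symm
  rw [hL, hR, ← lintegral_map ha hA, lintegral_prod _ (Measurable.aemeasurable ?_),
    lintegral_prod _ (Measurable.aemeasurable ?_)]
  · simp only
    have e : ∀ (u : α) (v : β),
        ∫⁻ q, a u * h q.1 (Φ (v, q.2)) ∂((P.map C).prod (P.map D))
          = a u * ∫⁻ q, h q.1 (Φ (v, q.2)) ∂((P.map C).prod (P.map D)) := fun u v =>
      lintegral_const_mul _ (hg'.comp measurable_prodMk_left)
    simp only [e]
    have e2 : ∀ u : α, ∫⁻ v, a u * ∫⁻ q, h q.1 (Φ (v, q.2)) ∂((P.map C).prod (P.map D)) ∂(P.map B)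
        = a u * ∫⁻ v, ∫⁻ q, h q.1 (Φ (v, q.2)) ∂((P.map C).prod (P.map D)) ∂(P.map B) := fun u =>
      lintegral_const_mul _ hg'.lintegral_prod_right'
    simp only [e2]
    rw [lintegral_mul_const _ ha, lintegral_prod _ hg.lintegral_prod_right'.aemeasurable]
    congr 1
    refine lintegral_congr fun v => ?_
    exact lintegral_prod_symm (fun q => h q.1 (Φ (v, q.2)))
      (hg'.comp (measurable_prodMk_left (x := v))).aemeasurable
  · refine Measurable.lintegral_prod_right' (f := fun p : (α × β) × (γ × δ) =>
      a p.1.1 * h p.2.1 (Φ (p.1.2, p.2.2))) ?_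
    exact (ha.comp (by fun_prop)).mul
      (hg'.comp (f := fun p : (α × β) × (γ × δ) => (p.1.2, p.2)) (by fun_prop))
  · exact (ha.comp (by fun_prop)).mul
      (hg'.comp (f := fun p : (α × β) × (γ × δ) => (p.1.2, p.2)) (by fun_prop))

/-! ### Stochastic common fixed points. -/

section CommonFix

variable {Ω K X : Type*} [MeasurableSpace Ω] {P : Measure Ω} [MetricSpace X]
  {T : K → X → X} {k : Ω → K}

theorem isClosed_commonFix (hT : ∀ c, Continuous (T c)) : IsClosed (commonFix P T k) := by
  refine isClosed_of_closure_subset fun y hy => ?_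
  obtain ⟨u, hu, huy⟩ := mem_closure_iff_seq_limit.1 hy
  have h : ∀ᵐ ω ∂P, ∀ n, T (k ω) (u n) = u n := ae_all_iff.2 hu
  filter_upwards [h] with ω hω
  refine tendsto_nhds_unique (((hT (k ω)).tendsto y).comp huy) ?_
  simpa only [Function.comp_def, hω] using huy

/-- Almost surely, every common fixed point is fixed by all maps selected along a sequence of
copies of the random index. -/
theorem ae_forall_mem_commonFix [MeasurableSpace K] [TopologicalSpace.SeparableSpace X]
    [MeasurableSpace X] [BorelSpace X] (hT : ∀ c, Continuous (T c))
    (hTmeas : Measurable fun p : K × X => T p.1 p.2) {κ : ℕ → Ω → K}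
    (hκ : ∀ n, IdentDistrib (κ n) k P P) :
    ∀ᵐ ω ∂P, ∀ z ∈ commonFix P T k, ∀ n, T (κ n ω) z = z := by
  have : SecondCountableTopology X := UniformSpace.secondCountable_of_separable X
  -- The exceptional null set depends on `z`, so only countably many `z` can be treated at once;
  -- closedness of each fixed-point set extends the result from a dense subset.
  obtain ⟨C, hCS, hC, hSC⟩ :=
    TopologicalSpace.IsSeparable.exists_countable_dense_subset
      (TopologicalSpace.IsSeparable.of_separableSpace (commonFix P T k))
  have h : ∀ᵐ ω ∂P, ∀ z ∈ C, ∀ n, T (κ n ω) z = z := by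
    refine (ae_ball_iff hC).2 fun z hz => ae_all_iff.2 fun n => ?_
    have hm : MeasurableSet {c | T c z = z} :=
      measurableSet_eq_fun (hTmeas.comp measurable_prodMk_right) measurable_const
    exact (hκ n).symm.ae_snd hm (hCS hz)
  filter_upwards [h] with ω hω z hz n
  have hcl : IsClosed {y | T (κ n ω) y = y} := isClosed_eq (hT _) continuous_id
  exact hcl.closure_subset_iff.2 (fun y hy => hω y hy n) (hSC hz)

end CommonFix

/-! ### Measurability and independence along the iteration. -/

section Iteration

variable {Ω K X : Type*} [MeasurableSpace K] [MetricSpace X] [CAT0Space X]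
  {T : K → X → X} {κ : ℕ → Ω → K} {lam : ℕ → Ω → ℝ} {x₀ : X} {x : ℕ → Ω → X}

/-- The `n`-th iterate is a measurable function of the first `n` step sizes and indices. -/
theorem exists_measurable_iterate_eq [TopologicalSpace.SeparableSpace X] [MeasurableSpace X]
    [BorelSpace X] (hTmeas : Measurable fun p : K × X => T p.1 p.2)
    (hlam : ∀ n ω, lam n ω ∈ Set.Icc (0 : ℝ) 1) (hx_zero : ∀ ω, x 0 ω = x₀)
    (hx_succ : ∀ n ω, x (n + 1) ω = geodesicComb (lam n ω) (x n ω) (T (κ n ω) (x n ω)))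
    (n : ℕ) :
    ∃ Φ : ((Finset.range n → ℝ) × (Finset.range n → K)) → X, Measurable Φ ∧
      ∀ ω, x n ω = Φ (fun i => lam i ω, fun i => κ i ω) := by
  induction n with
  | zero => exact ⟨fun _ => x₀, measurable_const, hx_zero⟩
  | succ n ih =>
    obtain ⟨Φ, hΦ, hxΦ⟩ := ih
    let e : Finset.range n → Finset.range (n + 1) := fun i =>
      ⟨i, Finset.range_subset_range.2 n.le_succ i.2⟩
    let l : Finset.range (n + 1) := ⟨n, Finset.self_mem_range_succ n⟩
    let y : ((Finset.range (n + 1) → ℝ) × (Finset.range (n + 1) → K)) → X := fun q =>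
      Φ (fun i => q.1 (e i), fun i => q.2 (e i))
    have hy : Measurable y := hΦ.comp (by fun_prop)
    -- Clipping makes the map measurable on all of its domain and leaves the actual step sizes
    -- unchanged.
    refine ⟨fun q => geodesicComb (Set.projIcc (0 : ℝ) 1 zero_le_one (q.1 l) : ℝ) (y q)
      (T (q.2 l) (y q)), ?_, fun ω => ?_⟩
    · have hTy : Measurable fun q : (Finset.range (n + 1) → ℝ) × (Finset.range (n + 1) → K) =>
          T (q.2 l) (y q) :=
        hTmeas.comp (((measurable_pi_apply l).comp measurable_snd).prodMk hy)
      exact measurable_geodesicComb_projIcc.comp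
        (((measurable_pi_apply l).comp measurable_fst).prodMk (hy.prodMk hTy))
    · simp only [y, e, l, hx_succ, Set.projIcc_of_mem zero_le_one (hlam n ω), ← hxΦ]

/-- The step size, the index and the iterate at time `n` are independent. -/
theorem lintegral_mul_edist_iterate [TopologicalSpace.SeparableSpace X] [MeasurableSpace X]
    [BorelSpace X] [MeasurableSpace Ω] {P : Measure Ω} [IsProbabilityMeasure P] {k : Ω → K}
    (hTmeas : Measurable fun p : K × X => T p.1 p.2)
    (hκmeas : ∀ n, Measurable (κ n)) (hκindep : iIndepFun κ P)
    (hκdistrib : ∀ n, IdentDistrib (κ n) k P P)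
    (hlam_meas : ∀ n, Measurable (lam n)) (hlam : ∀ n ω, lam n ω ∈ Set.Icc (0 : ℝ) 1)
    (hlam_indep : iIndepFun lam P)
    (hlam_κ : IndepFun (fun ω n => lam n ω) (fun ω n => κ n ω) P)
    (hx_zero : ∀ ω, x 0 ω = x₀)
    (hx_succ : ∀ n ω, x (n + 1) ω = geodesicComb (lam n ω) (x n ω) (T (κ n ω) (x n ω)))
    (n : ℕ) :
    ∫⁻ ω, ENNReal.ofReal (lam n ω * (1 - lam n ω)) * edist (T (κ n ω) (x n ω)) (x n ω) ^ 2 ∂P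
      = ENNReal.ofReal (∫ ω, lam n ω * (1 - lam n ω) ∂P)
        * ∫⁻ ω, meanSqResidual P T k (x n ω) ∂P := by
  have : SecondCountableTopology X := UniformSpace.secondCountable_of_separable X
  obtain ⟨Φ, hΦ, hxΦ⟩ := exists_measurable_iterate_eq hTmeas hlam hx_zero hx_succ n
  have hh : Measurable (Function.uncurry fun (c : K) (y : X) => edist (T c y) y ^ 2) :=
    (hTmeas.edist measurable_snd).pow_const 2
  have hl : Measurable fun (ω : Ω) (i : Finset.range n) => lam i ω :=
    measurable_pi_lambda _ fun i => hlam_meas i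
  have hκ : Measurable fun (ω : Ω) (i : Finset.range n) => κ i ω :=
    measurable_pi_lambda _ fun i => hκmeas i
  have hd : Disjoint {n} (Finset.range n) := by simp
  have hAB : IndepFun (lam n) (fun ω (i : Finset.range n) => lam i ω) P :=
    (hlam_indep.indepFun_finset _ _ hd hlam_meas).comp (measurable_pi_apply
      (⟨n, Finset.mem_singleton_self n⟩ : ({n} : Finset ℕ))) measurable_id
  have hCD : IndepFun (κ n) (fun ω (i : Finset.range n) => κ i ω) P :=
    (hκindep.indepFun_finset _ _ hd hκmeas).comp (measurable_pi_apply
      (⟨n, Finset.mem_singleton_self n⟩ : ({n} : Finset ℕ))) measurable_id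
  have hABCD : IndepFun (fun ω => (lam n ω, fun i : Finset.range n => lam i ω))
      (fun ω => (κ n ω, fun i : Finset.range n => κ i ω)) P :=
    hlam_κ.comp (φ := fun u => (u n, fun i : Finset.range n => u i))
      (ψ := fun u => (u n, fun i : Finset.range n => u i)) (by fun_prop) (by fun_prop)
  have key := lintegral_mul_comp_of_indepFun (hlam_meas n) hl (hκmeas n) hκ hAB hCD hABCD
    (a := fun t => ENNReal.ofReal (t * (1 - t))) (by fun_prop) hh hΦ
  simp only [← hxΦ] at key
  rw [key]
  congr 1
  · refine (ofReal_integral_eq_lintegral_ofReal ?_ ?_).symm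
    · refine Integrable.of_bound (C := 1) (by fun_prop) (ae_of_all _ fun ω => ?_)
      obtain ⟨h0, h1⟩ := hlam n ω
      rw [Real.norm_eq_abs, abs_le]
      constructor <;> nlinarith
    · exact ae_of_all _ fun ω => mul_nonneg (hlam n ω).1 (sub_nonneg.2 (hlam n ω).2)
  · refine lintegral_congr fun ω => ?_
    exact ((hκdistrib n).comp (hh.comp measurable_prodMk_right)).lintegral_eq

end Iteration

/-- Integrate 2a ≤ (2/ε)a² + ε/2; under the hypothesis the first term contributes less than ε/2. -/
theorem two_mul_lintegral_lt_of_lintegral_sq_lt {Ω : Type*} [MeasurableSpace Ω] {P : Measure Ω}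
    [IsProbabilityMeasure P] {f : Ω → ℝ≥0∞} (hf : Measurable f) {ε : ℝ} (hε : 0 < ε)
    (h : ∫⁻ ω, f ω ^ 2 ∂P < ENNReal.ofReal (ε ^ 2 / 4)) :
    2 * ∫⁻ ω, f ω ∂P < ENNReal.ofReal ε := by
  have hp : ∀ a : ℝ≥0∞, 2 * a ≤ ENNReal.ofReal (2 / ε) * a ^ 2 + ENNReal.ofReal (ε / 2) := by
    intro a
    rcases eq_or_ne a ∞ with rfl | ha
    · simp [ENNReal.mul_top, hε]
    · lift a to NNReal using ha
      rw [← ENNReal.ofReal_coe_nnreal, ← ENNReal.ofReal_pow a.coe_nonneg,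
        ← ENNReal.ofReal_mul (by positivity), ← ENNReal.ofReal_add (by positivity) (by positivity),
        ← ENNReal.ofReal_ofNat 2, ← ENNReal.ofReal_mul (by positivity)]
      apply ENNReal.ofReal_le_ofReal
      have e : 2 / ε * (a : ℝ) ^ 2 + ε / 2 - 2 * a = 2 / ε * (a - ε / 2) ^ 2 := by
        field_simp; ring
      have : 0 ≤ 2 / ε * ((a : ℝ) - ε / 2) ^ 2 := by positivity
      linarith
  calc 2 * ∫⁻ ω, f ω ∂P = ∫⁻ ω, 2 * f ω ∂P := (lintegral_const_mul _ hf).symm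
    _ ≤ ∫⁻ ω, (ENNReal.ofReal (2 / ε) * f ω ^ 2 + ENNReal.ofReal (ε / 2)) ∂P :=
      lintegral_mono fun ω => hp (f ω)
    _ = ENNReal.ofReal (2 / ε) * ∫⁻ ω, f ω ^ 2 ∂P + ENNReal.ofReal (ε / 2) := by
      rw [lintegral_add_right _ measurable_const, lintegral_const_mul _ (hf.pow_const 2)]
      simp
    _ < ENNReal.ofReal (2 / ε) * ENNReal.ofReal (ε ^ 2 / 4) + ENNReal.ofReal (ε / 2) := by
      refine ENNReal.add_lt_add_right ENNReal.ofReal_ne_top ?_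
      exact ENNReal.mul_lt_mul_right (by simpa using hε) ENNReal.ofReal_ne_top h
    _ = ENNReal.ofReal ε := by
      rw [← ENNReal.ofReal_mul (by positivity), ← ENNReal.ofReal_add (by positivity) (by positivity)]
      congr 1
      field_simp
      ring

/-- A sequence with summable weighted residuals has a small residual as soon as the sum of the
weights is large. -/
theorem exists_lt_of_energy_le {E F : ℕ → ℝ≥0∞} {a : ℕ → ℝ} (ha : ∀ n, 0 ≤ a n)
    (hE : ∀ n, E (n + 1) + ENNReal.ofReal (a n) * F n ≤ E n) {b t : ℝ} (ht : 0 < t)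
    (hb : E 0 < ENNReal.ofReal b) {N : ℕ} (hN : b / t ≤ ∑ n ∈ Finset.range N, a n) :
    ∃ n < N, F n < ENNReal.ofReal t := by
  -- Telescoping in additive form, since subtraction in `ℝ≥0∞` is truncated.
  have hsum : ∀ N, E N + ∑ n ∈ Finset.range N, ENNReal.ofReal (a n) * F n ≤ E 0 := by
    intro N
    induction N with
    | zero => simp
    | succ N ih =>
      rw [Finset.sum_range_succ, add_comm (∑ n ∈ _, _), ← add_assoc]
      exact (add_le_add_left (hE N) _).trans ih
  by_contra! hF
  refine hb.not_ge ?_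
  calc ENNReal.ofReal b ≤ ENNReal.ofReal ((∑ n ∈ Finset.range N, a n) * t) :=
        ENNReal.ofReal_le_ofReal ((div_le_iff₀ ht).1 hN)
    _ = ∑ n ∈ Finset.range N, ENNReal.ofReal (a n) * ENNReal.ofReal t := by
        rw [ENNReal.ofReal_mul (Finset.sum_nonneg fun n _ => ha n),
          ENNReal.ofReal_sum_of_nonneg fun n _ => ha n, Finset.sum_mul]
    _ ≤ ∑ n ∈ Finset.range N, ENNReal.ofReal (a n) * F n :=
        Finset.sum_le_sum fun n hn => by gcongr; exact hF n (Finset.mem_range.1 hn)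
    _ ≤ E 0 := le_add_self.trans (hsum N)

/-- An antitone sequence of random variables whose integrals become small tends to zero. -/
theorem ae_tendsto_zero_of_antitone_of_lintegral {Ω : Type*} [MeasurableSpace Ω] {P : Measure Ω}
    {f : ℕ → Ω → ℝ≥0∞} (hf : ∀ n, Measurable (f n)) (hanti : ∀ᵐ ω ∂P, Antitone fun n => f n ω)
    (h : ∀ ε : ℝ, 0 < ε → ∃ n, ∫⁻ ω, f n ω ∂P < ENNReal.ofReal ε) :
    ∀ᵐ ω ∂P, Tendsto (fun n => f n ω) atTop (𝓝 0) := by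
  have h0 : ∫⁻ ω, ⨅ n, f n ω ∂P = 0 := by
    refine le_antisymm (le_of_forall_gt fun c hc => ?_) zero_le
    obtain ⟨r, hr, hrc⟩ := ENNReal.lt_iff_exists_real_btwn.1 hc
    obtain ⟨n, hn⟩ := h r (ENNReal.ofReal_pos.1 hrc.1)
    exact ((lintegral_mono fun ω => iInf_le _ n).trans_lt hn).trans hrc.2
  have h1 := (lintegral_eq_zero_iff (Measurable.iInf hf)).1 h0
  filter_upwards [hanti, h1] with ω hω h1ω
  have h2 := tendsto_atTop_iInf hω
  rwa [show ⨅ n, f n ω = 0 from h1ω] at h2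

/-! ### Convergence and rates. -/

theorem mainTheorem7
    {Ω K X : Type*} [MeasurableSpace Ω] [MeasurableSpace K]
    (P : Measure Ω) [IsProbabilityMeasure P]
    -- a separable Hadamard space with its Borel sets
    [MetricSpace X] [CAT0Space X] [CompleteSpace X] [TopologicalSpace.SeparableSpace X]
    [MeasurableSpace X] [BorelSpace X]
    -- a jointly measurable family of nonexpansive maps, with a common fixed point
    (T : K → X → X) (hT : ∀ c, LipschitzWith 1 (T c))
    (hTmeas : Measurable (fun p : K × X => T p.1 p.2))
    (k : Ω → K) (hk : Measurable k) (hFix : (commonFix P T k).Nonempty)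
    -- the random indices and the random step sizes
    (κ : ℕ → Ω → K) (lam : ℕ → Ω → ℝ)
    (hκmeas : ∀ n, Measurable (κ n)) (hκindep : iIndepFun κ P)
    (hκdistrib : ∀ n, IdentDistrib (κ n) k P P)
    (hlam_meas : ∀ n, Measurable (lam n)) (hlam : ∀ n ω, lam n ω ∈ Set.Ioc (0 : ℝ) 1)
    (hlam_indep : iIndepFun lam P)
    (hlam_κ : IndepFun (fun ω n => lam n ω) (fun ω n => κ n ω) P)
    (hlam_sum : Tendsto (fun N => ∑ n ∈ Finset.range N, ∫ ω, lam n ω * (1 - lam n ω) ∂P)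
      atTop atTop)
    -- the randomized Krasnoselskii–Mann iteration
    (x₀ : X) (x : ℕ → Ω → X) (hx_zero : ∀ ω, x 0 ω = x₀)
    (hx_succ : ∀ n ω, x (n + 1) ω = geodesicComb (lam n ω) (x n ω) (T (κ n ω) (x n ω)))
    -- regularity in mean
    (D : Set (Ω → X)) (hDmeas : ∀ y ∈ D, Measurable y) (hxD : ∀ n, x n ∈ D)
    (τ : ℝ → ℝ)
    (hτ : IsRegularityModulusInMean P (meanSqResidual P T k) (commonFix P T k) D τ) :
    ∃ xlim : Ω → X, Measurable xlim ∧ (∀ ω, xlim ω ∈ commonFix P T k) ∧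
      (∀ᵐ ω ∂P, Tendsto (fun n => x n ω) atTop (𝓝 (xlim ω))) ∧
      Tendsto (fun n => ∫⁻ ω, edist (x n ω) (xlim ω) ∂P) atTop (𝓝 0) ∧
      ∀ z ∈ commonFix P T k, ∀ b : ℝ, dist x₀ z ^ 2 < b →
        ∀ θ : ℕ → ℝ → ℕ,
          (∀ (m : ℕ) (c : ℝ), 0 < c →
            c ≤ ∑ n ∈ Finset.Icc m (θ m c), ∫ ω, lam n ω * (1 - lam n ω) ∂P) →
          (∀ ε : ℝ, 0 < ε → ∀ n ≥ kmRate θ τ b (ε ^ 2 / 4),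
            ∫⁻ ω, edist (x n ω) (xlim ω) ∂P < ENNReal.ofReal ε) ∧
          (∀ δ ε : ℝ, 0 < δ → 0 < ε →
            P {ω | ∃ n ≥ kmRate θ τ b (δ * ε ^ 2 / 4), ε ≤ dist (x n ω) (xlim ω)}
              < ENNReal.ofReal δ) := by
  have : SecondCountableTopology X := UniformSpace.secondCountable_of_separable X
  set S := commonFix P T k with hSdef
  have hTc : ∀ c, Continuous (T c) := fun c => (hT c).continuous
  have hS : IsClosed S := isClosed_commonFix hTc
  have hxm : ∀ n, Measurable (x n) := fun n => hDmeas _ (hxD n)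
  have hlam' : ∀ n ω, lam n ω ∈ Set.Icc (0 : ℝ) 1 := fun n ω => ⟨(hlam n ω).1.le, (hlam n ω).2⟩
  have hdm : ∀ n, Measurable fun ω => Metric.infEDist (x n ω) S := fun n => (hxm n).infEDist
  -- the basic energy inequality, which implies Fejér monotonicity
  have hstep : ∀ᵐ ω ∂P, ∀ z ∈ S, ∀ n,
      edist (x (n + 1) ω) z ^ 2 + ENNReal.ofReal (lam n ω * (1 - lam n ω))
        * edist (T (κ n ω) (x n ω)) (x n ω) ^ 2 ≤ edist (x n ω) z ^ 2 := by
    filter_upwards [ae_forall_mem_commonFix hTc hTmeas hκdistrib] with ω hω z hz n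
    rw [hx_succ]
    refine edist_geodesicComb_sq_add_le (hlam' n ω) ?_
    have h := (hT (κ n ω)).dist_le_mul (x n ω) z
    rwa [hω z hz n, NNReal.coe_one, one_mul] at h
  have hfejer : ∀ᵐ ω ∂P, ∀ z ∈ S, ∀ n, edist (x (n + 1) ω) z ≤ edist (x n ω) z := by
    filter_upwards [hstep] with ω hω z hz n
    exact (ENNReal.pow_le_pow_left_iff two_ne_zero).1 (le_self_add.trans (hω z hz n))
  have ha : ∀ n, 0 ≤ ∫ ω, lam n ω * (1 - lam n ω) ∂P := fun n =>
    integral_nonneg fun ω => mul_nonneg (hlam' n ω).1 (sub_nonneg.2 (hlam' n ω).2)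
  have hrate : ∀ z ∈ S, ∀ b : ℝ, dist x₀ z ^ 2 < b → ∀ ε : ℝ, 0 < ε → ∀ N : ℕ,
      b / τ ε ≤ ∑ n ∈ Finset.range (N + 1), ∫ ω, lam n ω * (1 - lam n ω) ∂P →
      ∀ n ≥ N, ∫⁻ ω, Metric.infEDist (x n ω) S ^ 2 ∂P < ENNReal.ofReal ε := by
    intro z hz b hb ε hε N hN n hn
    have hE0 : ∫⁻ ω, edist (x 0 ω) z ^ 2 ∂P < ENNReal.ofReal b := by
      simp only [hx_zero, lintegral_const, measure_univ, mul_one]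
      rw [edist_dist, ← ENNReal.ofReal_pow dist_nonneg]
      exact (ENNReal.ofReal_lt_ofReal_iff ((sq_nonneg _).trans_lt hb)).2 hb
    obtain ⟨m, hm, hFm⟩ := exists_lt_of_energy_le (E := fun n => ∫⁻ ω, edist (x n ω) z ^ 2 ∂P)
      (F := fun n => ∫⁻ ω, meanSqResidual P T k (x n ω) ∂P) ha (fun n => by
        rw [← lintegral_mul_edist_iterate hTmeas hκmeas hκindep hκdistrib hlam_meas hlam'
          hlam_indep hlam_κ hx_zero hx_succ n,
          ← lintegral_add_left (((hxm (n + 1)).edist measurable_const).pow_const 2)]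
        refine lintegral_mono_ae ?_
        filter_upwards [hstep] with ω hω using hω z hz n) (hτ.1 ε hε) hE0 hN
    -- The good time `m` is only known to be at most `N`; monotonicity carries its bound to every `n
    -- ≥ N`.
    refine (lintegral_mono_ae ?_).trans_lt (hτ.2 ε hε _ (hxD m) hFm)
    filter_upwards [hfejer] with ω hω
    gcongr
    exact infEDist_le_of_fejer hω (by omega)
  have hL1 : ∀ ε : ℝ, 0 < ε → ∃ N, ∀ n ≥ N,
      2 * ∫⁻ ω, Metric.infEDist (x n ω) S ∂P < ENNReal.ofReal ε := by
    intro ε hε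
    obtain ⟨z, hz⟩ := hFix
    obtain ⟨N, hN⟩ := ((tendsto_add_atTop_iff_nat 1).2 hlam_sum |>.eventually_ge_atTop
      ((dist x₀ z ^ 2 + 1) / τ (ε ^ 2 / 4))).exists
    exact ⟨N, fun n hn => two_mul_lintegral_lt_of_lintegral_sq_lt (hdm n) hε
      (hrate z hz _ (lt_add_one _) _ (by positivity) N hN n hn)⟩
  have hd0 : ∀ᵐ ω ∂P, Tendsto (fun n => Metric.infEDist (x n ω) S) atTop (𝓝 0) := by
    refine ae_tendsto_zero_of_antitone_of_lintegral hdm ?_ fun ε hε => ?_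
    · filter_upwards [hfejer] with ω hω m n hmn using infEDist_le_of_fejer hω hmn
    · obtain ⟨N, hN⟩ := hL1 ε hε
      exact ⟨N, (le_mul_of_one_le_left' one_le_two).trans_lt (hN N le_rfl)⟩
  -- the limit
  have hconv : ∀ᵐ ω ∂P, ∃ y ∈ S, Tendsto (fun n => x n ω) atTop (𝓝 y) := by
    filter_upwards [hfejer, hd0] with ω hω h0 using exists_tendsto_of_fejer hS hω h0
  obtain ⟨g, hg, hxg⟩ := measurable_limit_of_tendsto_metrizable_ae
    (fun n => (hxm n).aemeasurable) (hconv.mono fun ω ⟨y, _, hy⟩ => ⟨y, hy⟩)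
  obtain ⟨z₀, hz₀⟩ := hFix
  classical
  -- The limit `g` lies in `S` only almost surely; redefining it as `z₀` elsewhere puts every value
  -- in `S`.
  refine ⟨(g ⁻¹' S).piecewise g fun _ => z₀,
    hg.piecewise (hg hS.measurableSet) measurable_const, fun ω => ?_, ?_⟩
  · by_cases h : ω ∈ g ⁻¹' S
    · rwa [Set.piecewise_eq_of_mem _ _ _ h]
    · rwa [Set.piecewise_eq_of_notMem _ _ _ h]
  set xlim := (g ⁻¹' S).piecewise g fun _ => z₀
  have hlim : ∀ᵐ ω ∂P, Tendsto (fun n => x n ω) atTop (𝓝 (xlim ω)) := by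
    filter_upwards [hconv, hxg] with ω ⟨y, hyS, hy⟩ h
    have hgS : ω ∈ g ⁻¹' S := by
      rwa [Set.mem_preimage, tendsto_nhds_unique h hy]
    simpa only [xlim, Set.piecewise_eq_of_mem _ _ _ hgS] using h
  have hdist : ∀ᵐ ω ∂P, ∀ n, edist (x n ω) (xlim ω) ≤ 2 * Metric.infEDist (x n ω) S := by
    filter_upwards [hfejer, hlim] with ω hω hl n
    exact edist_limit_le_two_mul_infEDist_of_fejer hω hl n
  have hmean : ∀ n, ∫⁻ ω, edist (x n ω) (xlim ω) ∂P ≤ 2 * ∫⁻ ω, Metric.infEDist (x n ω) S ∂P := by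
    intro n
    rw [← lintegral_const_mul _ (hdm n)]
    exact lintegral_mono_ae (hdist.mono fun ω hω => hω n)
  refine ⟨hlim, ?_, fun z hz b hb θ hθ => ?_⟩
  · refine ENNReal.tendsto_nhds_zero.2 fun c hc => ?_
    obtain ⟨r, hr, hrc⟩ := ENNReal.lt_iff_exists_real_btwn.1 hc
    obtain ⟨N, hN⟩ := hL1 r (ENNReal.ofReal_pos.1 hrc.1)
    filter_upwards [eventually_ge_atTop N] with n hn
    exact ((hmean n).trans_lt ((hN n hn).trans hrc.2)).le
  have hb0 : 0 < b := (sq_nonneg _).trans_lt hb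
  -- The argument yields the bound `ε / 6`; the factor 6 is slack, dropped in both rates below.
  have hkm : ∀ ε : ℝ, 0 < ε → ∀ n ≥ kmRate θ τ b ε,
      ∫⁻ ω, Metric.infEDist (x n ω) S ^ 2 ∂P < ENNReal.ofReal (ε / 6) := by
    intro ε hε n hn
    have hε6 : 0 < ε / 6 := by positivity
    refine hrate z hz b hb _ hε6 _ ?_ n hn
    rw [Nat.range_succ_eq_Icc_zero]
    exact hθ 0 _ (div_pos hb0 (hτ.1 _ hε6))
  constructor
  · intro ε hε n hn
    refine (hmean n).trans_lt (two_mul_lintegral_lt_of_lintegral_sq_lt (hdm n) hε ?_)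
    refine (hkm _ (by positivity) n hn).trans_le (ENNReal.ofReal_le_ofReal ?_)
    exact div_le_self (by positivity) (by norm_num)
  · intro δ ε hδ hε
    set N := kmRate θ τ b (δ * ε ^ 2 / 4)
    -- Monotonicity of the distance to `S` reduces the event over all `n ≥ N` to one at time `N`, so
    -- a single use of Markov's inequality suffices.
    have hsub : P {ω | ∃ n ≥ N, ε ≤ dist (x n ω) (xlim ω)}
        ≤ P {ω | ENNReal.ofReal (ε ^ 2 / 4) ≤ Metric.infEDist (x N ω) S ^ 2} := by
      refine measure_mono_ae ?_
      filter_upwards [hfejer, hdist] with ω hω hd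
      rintro ⟨n, hn, hε'⟩
      have h1 : ENNReal.ofReal ε ≤ 2 * Metric.infEDist (x N ω) S := by
        refine (ENNReal.ofReal_le_ofReal hε').trans ?_
        rw [← edist_dist]
        refine (hd n).trans ?_
        gcongr
        exact infEDist_le_of_fejer hω hn
      have h2 : ENNReal.ofReal (ε / 2) ≤ Metric.infEDist (x N ω) S := by
        rw [ENNReal.ofReal_div_of_pos two_pos, ENNReal.ofReal_ofNat]
        exact ENNReal.div_le_of_le_mul' h1
      change ENNReal.ofReal (ε ^ 2 / 4) ≤ Metric.infEDist (x N ω) S ^ 2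
      rw [show ε ^ 2 / 4 = (ε / 2) ^ 2 by ring, ENNReal.ofReal_pow (by positivity)]
      gcongr
    have hpos : 0 < ε ^ 2 / 4 := by positivity
    refine (hsub.trans (meas_ge_le_lintegral_div ((hdm N).pow_const 2).aemeasurable
      (by simpa using hpos) ENNReal.ofReal_ne_top)).trans_lt ?_
    refine ENNReal.div_lt_of_lt_mul ((hkm _ (by positivity) N le_rfl).trans_le ?_)
    rw [← ENNReal.ofReal_mul hδ.le]
    refine ENNReal.ofReal_le_ofReal ?_
    rw [← mul_div_assoc]
    exact div_le_self (by positivity) (by norm_num)
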